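/- Let $S$ be a QF-ring, that is, a ring over which a left module is projective if and only if it is injective; all modules are left $S$-modules. Let $\mathrm{StMod}(S)$ be the stable module category: its objects are all $S$-modules, and its morphisms are $\mathrm{Hom}_S(M,N)/\mathrm{PHom}_S(M,N)$, where $\mathrm{PHom}_S(M,N)$ consists of the homomorphisms that factor through a projective module. Let $\mathrm{Stmod}(S)$ be its full subcategory on the finitely generated modules, with its usual triangulated structure: for each finitely generated $X$ fix an exact sequence $0\to X\to I(X)\to TX\to 0$ with $I(X)$ finitely generated injective; the triangles are the sextuples isomorphic to some $X\xrightarrow{f}Y\to C_f\to TX$, where $f$ is a homomorphism of finitely generated modules, $C_f$ is the pushout of $X\to I(X)$ along $f$, and $C_f\to TX$ is zero on $Y$ and the projection on $I(X)$. Let $\underline{G}_0(S)=K_0(\mathrm{Stmod}(S))$ be the abelian group generated by the isomorphism classes $[X]$ of objects of $\mathrm{Stmod}(S)$ with the relations $[V]=[U]+[W]$ for all triangles $U\to V\to W\to TU$ in $\mathrm{Stmod}(S)$. Call an $S$-module $M$ stably finitely generated if it is isomorphic in $\mathrm{StMod}(S)$ to a finitely generated module $M'$; in that case put $\theta(M)=[M']\in\underline{G}_0(S)$,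 which does not depend on the choice of $M'$. **Lemma 2.2.** Let $0\to U\to V\to W\to 0$ be an exact sequence of $S$-modules. If two of $U,V,W$ are stably finitely generated, then so is the third. In this case, $$\theta(V)=\theta(U)+\theta(W)\quad\text{in }\underline{G}_0(S).$$ -/

import Mathlib

open CategoryTheory CategoryTheory.Limits

universe u

/-- A QF-ring (quasi-Frobenius ring): a ring over which a left module is projective if and only
if it is injective. -/
class IsQFRing (S : Type u) [Ring S] : Prop where
  projective_iff_injective : ∀ (M : Type u) [AddCommGroup M] [Module S M],
    Module.Projective S M ↔ Module.Injective S M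

/-- A homomorphism of `S`-modules factors through a projective module; these homomorphisms
`M ⟶ N` form `PHom_S(M, N)`. -/
def FactorsThroughProjective {S : Type u} [Ring S] {M N : ModuleCat.{u} S} (f : M ⟶ N) : Prop :=
  ∃ (P : ModuleCat.{u} S) (a : M ⟶ P) (b : P ⟶ N), Module.Projective S P ∧ a ≫ b = f

/-- Two homomorphisms are equivalent if their difference factors through a projective module. -/
def stableRel (S : Type u) [Ring S] : HomRel (ModuleCat.{u} S) :=
  fun _ _ f g => FactorsThroughProjective (f - g)

/-- The relation is an equivalence relation compatible with composition, so that the morphisms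
of the quotient category are exactly `Hom_S(M, N) / PHom_S(M, N)`. -/
instance stableRel_congruence (S : Type u) [Ring S] : Congruence (stableRel S) where
  equivalence {X Y} :=
    { refl := fun f => ⟨ModuleCat.of S PUnit, 0, 0, inferInstance, by simp⟩
      symm := by
        rintro f g ⟨P, a, b, hP, h⟩
        exact ⟨P, a, -b, hP, by rw [Preadditive.comp_neg, h, neg_sub]⟩
      trans := by
        rintro f g h ⟨P, a, b, hP, e⟩ ⟨Q, c, d, hQ, e'⟩
        refine ⟨ModuleCat.of S (P × Q), ModuleCat.ofHom (a.hom.prod c.hom),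
          ModuleCat.ofHom (b.hom.coprod d.hom), inferInstance, ?_⟩
        have : f - h = a ≫ b + c ≫ d := by rw [e, e']; abel
        rw [this]
        ext x
        simp }
  comp_left {X Y Z} f {g g'} := by
    rintro ⟨P, a, b, hP, h⟩
    exact ⟨P, f ≫ a, b, hP, by simp [h]⟩
  comp_right {X Y Z} {f f'} g := by
    rintro ⟨P, a, b, hP, h⟩
    exact ⟨P, a, b ≫ g, hP, by rw [reassoc_of% h, Preadditive.sub_comp]⟩

/-- The stable module category `StMod(S)`: its objects are all `S`-modules, its morphisms are
the homomorphisms modulo those that factor through a projective module. -/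
abbrev StMod (S : Type u) [Ring S] := CategoryTheory.Quotient (stableRel S)

/-- The canonical functor `M ↦ M̲` from `Mod(S)` to `StMod(S)`. -/
abbrev toStMod (S : Type u) [Ring S] : ModuleCat.{u} S ⥤ StMod S :=
  CategoryTheory.Quotient.functor (stableRel S)

/-- The finitely generated modules, as objects of the stable category. -/
def stIsFG (S : Type u) [Ring S] : ObjectProperty (StMod S) :=
  fun M => Module.Finite S M.as

/-- The stable category `Stmod(S)` of finitely generated modules, with objects the finitely
generated `S`-modules and morphisms the homomorphisms modulo those that factor through a
projective module. -/
abbrev FGStMod (S : Type u) [Ring S] := (stIsFG S).FullSubcategory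

/-- The canonical functor `M ↦ M̲` from `mod(S)` to `Stmod(S)`. -/
abbrev toFGStMod (S : Type u) [Ring S] : FGModuleCat.{u} S ⥤ FGStMod S :=
  (stIsFG S).lift ((ModuleCat.isFG S).ι ⋙ toStMod S) (fun M => M.property)

theorem exists_injective_extension {S : Type u} [Ring S] {A B Q : ModuleCat.{u} S} (i : A ⟶ B) [Mono i] (f : A ⟶ Q)
    (hQ : Module.Injective S Q) : ∃ g : B ⟶ Q, i ≫ g = f := by
  obtain ⟨g, hg⟩ := hQ.out i.hom ((ModuleCat.mono_iff_injective _).1 inferInstance) f.hom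
  exact ⟨ModuleCat.ofHom g, by ext x; simpa using hg x⟩

section Shift

variable (S : Type u) [Ring S] [IsQFRing S]

/-- Every module over a QF-ring embeds into an injective one, which can be taken finitely
generated if the given module is. -/
theorem exists_injective_embedding (X : ModuleCat.{u} S) :
    ∃ (I : ModuleCat.{u} S) (i : X ⟶ I), Module.Injective S I ∧ Mono i ∧
      (Module.Finite S X → Module.Finite S I) := by
  have hunder : Module.Injective S (Injective.under X : ModuleCat.{u} S) :=
    Module.injective_module_of_injective_object S _
      (inj := inferInstanceAs (CategoryTheory.Injective (Injective.under X)))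
  by_cases hX : Module.Finite S X
  · have hproj := (IsQFRing.projective_iff_injective (S := S)
      (Injective.under X : ModuleCat.{u} S)).2 hunder
    obtain ⟨s, hs⟩ := Module.projective_def.1 hproj
    have hι : Function.Injective (Injective.ι X).hom :=
      (ModuleCat.mono_iff_injective _).1 inferInstance
    let g : X →ₗ[S] ((Injective.under X : ModuleCat.{u} S) →₀ S) := s ∘ₗ (Injective.ι X).hom
    have hg : Function.Injective g := hs.injective.comp hι
    obtain ⟨t, ht⟩ := hX.fg_top
    classical
    let T : Finset (Injective.under X : ModuleCat.{u} S) := t.biUnion fun x => (g x).support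
    have hT : ∀ x, g x ∈ Finsupp.supported S S (T : Set (Injective.under X : ModuleCat.{u} S)) := by
      intro x
      have hx : x ∈ Submodule.span S (t : Set X) := ht ▸ Submodule.mem_top
      have hle : Submodule.span S (t : Set X) ≤ (Finsupp.supported S S
          (T : Set (Injective.under X : ModuleCat.{u} S))).comap g := by
        refine Submodule.span_le.2 fun y hy => ?_
        rw [SetLike.mem_coe, Submodule.mem_comap, Finsupp.mem_supported]
        exact_mod_cast Finset.subset_biUnion_of_mem (fun x => (g x).support) hy
      exact hle hx
    let e := Finsupp.supportedEquivFinsupp (R := S) (M := S)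
      (T : Set (Injective.under X : ModuleCat.{u} S))
    let g' := e.toLinearMap ∘ₗ g.codRestrict _ hT
    have hg' : Function.Injective g' := fun x y h =>
      hg (congrArg Subtype.val (e.injective h : g.codRestrict _ hT x = g.codRestrict _ hT y))
    exact ⟨ModuleCat.of S (_ →₀ S), ModuleCat.ofHom g',
      (IsQFRing.projective_iff_injective _).1 inferInstance,
      (ModuleCat.mono_iff_injective _).2 hg', fun _ => inferInstance⟩
  · exact ⟨Injective.under X, Injective.ι X, hunder, inferInstance, fun h => absurd h hX⟩

variable {S}

/-- A chosen injective module `I(X)` containing `X`, finitely generated if `X` is. -/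
noncomputable def injHull (X : ModuleCat.{u} S) : ModuleCat.{u} S :=
  (exists_injective_embedding S X).choose

/-- The chosen embedding `X ⟶ I(X)`. -/
noncomputable def injEmb (X : ModuleCat.{u} S) : X ⟶ injHull X :=
  (exists_injective_embedding S X).choose_spec.choose

instance injHull_injective (X : ModuleCat.{u} S) : Module.Injective S (injHull X) :=
  (exists_injective_embedding S X).choose_spec.choose_spec.1

instance injEmb_mono (X : ModuleCat.{u} S) : Mono (injEmb X) :=
  (exists_injective_embedding S X).choose_spec.choose_spec.2.1

theorem injHull_finite (X : ModuleCat.{u} S) (h : Module.Finite S X) :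
    Module.Finite S (injHull X) :=
  (exists_injective_embedding S X).choose_spec.choose_spec.2.2 h

/-- The cokernel `TX` in the exact sequence `0 ⟶ X ⟶ I(X) ⟶ TX ⟶ 0`. -/
noncomputable def cosyz (X : ModuleCat.{u} S) : ModuleCat.{u} S := cokernel (injEmb X)

/-- The projection `I(X) ⟶ TX`. -/
noncomputable def cosyzProj (X : ModuleCat.{u} S) : injHull X ⟶ cosyz X := cokernel.π (injEmb X)

instance cosyzProj_epi (X : ModuleCat.{u} S) : Epi (cosyzProj X) :=
  inferInstanceAs (Epi (cokernel.π (injEmb X)))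

theorem injEmb_cosyzProj (X : ModuleCat.{u} S) : injEmb X ≫ cosyzProj X = 0 :=
  cokernel.condition _

theorem cosyz_finite (X : ModuleCat.{u} S) (h : Module.Finite S X) :
    Module.Finite S (cosyz X) :=
  have := injHull_finite X h
  Module.Finite.of_surjective (cosyzProj X).hom ((ModuleCat.epi_iff_surjective _).1 inferInstance)

theorem exists_cosyz_desc {X Q : ModuleCat.{u} S} (f : injHull X ⟶ Q) (h : injEmb X ≫ f = 0) :
    ∃ g : cosyz X ⟶ Q, cosyzProj X ≫ g = f :=
  ⟨cokernel.desc _ f h, cokernel.π_desc _ _ _⟩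

theorem exists_cosyz_map {X Y : ModuleCat.{u} S} (f : X ⟶ Y) :
    ∃ (F : injHull X ⟶ injHull Y) (g : cosyz X ⟶ cosyz Y),
      injEmb X ≫ F = f ≫ injEmb Y ∧ cosyzProj X ≫ g = F ≫ cosyzProj Y := by
  obtain ⟨F, hF⟩ := exists_injective_extension (injEmb X) (f ≫ injEmb Y) inferInstance
  obtain ⟨g, hg⟩ := exists_cosyz_desc (F ≫ cosyzProj Y)
    (by rw [reassoc_of% hF, injEmb_cosyzProj, comp_zero])
  exact ⟨F, g, hF, hg⟩

/-- An extension `I(f) : I(X) ⟶ I(Y)` of a homomorphism `f : X ⟶ Y`. -/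
noncomputable def injHullMap {X Y : ModuleCat.{u} S} (f : X ⟶ Y) : injHull X ⟶ injHull Y :=
  (exists_cosyz_map f).choose

/-- The homomorphism `TX ⟶ TY` induced by `I(f)`. -/
noncomputable def cosyzMap {X Y : ModuleCat.{u} S} (f : X ⟶ Y) : cosyz X ⟶ cosyz Y :=
  (exists_cosyz_map f).choose_spec.choose

theorem injEmb_injHullMap {X Y : ModuleCat.{u} S} (f : X ⟶ Y) :
    injEmb X ≫ injHullMap f = f ≫ injEmb Y :=
  (exists_cosyz_map f).choose_spec.choose_spec.1

theorem cosyzProj_cosyzMap {X Y : ModuleCat.{u} S} (f : X ⟶ Y) :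
    cosyzProj X ≫ cosyzMap f = injHullMap f ≫ cosyzProj Y :=
  (exists_cosyz_map f).choose_spec.choose_spec.2

/-- Homomorphisms `TX ⟶ TY` that are induced by stably equivalent homomorphisms `X ⟶ Y` are
stably equivalent. -/
theorem cosyz_map_unique {X Y : ModuleCat.{u} S} {f f' : X ⟶ Y} (hf : stableRel S f f')
    {F F' : injHull X ⟶ injHull Y} {g g' : cosyz X ⟶ cosyz Y}
    (hF : injEmb X ≫ F = f ≫ injEmb Y) (hg : cosyzProj X ≫ g = F ≫ cosyzProj Y)
    (hF' : injEmb X ≫ F' = f' ≫ injEmb Y) (hg' : cosyzProj X ≫ g' = F' ≫ cosyzProj Y) :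
    stableRel S g g' := by
  obtain ⟨P, a, b, hP, h⟩ := hf
  obtain ⟨a', ha'⟩ := exists_injective_extension (injEmb X) a
    ((IsQFRing.projective_iff_injective P).1 hP)
  have hd : injEmb X ≫ (F - F' - a' ≫ b ≫ injEmb Y) = 0 := by
    rw [Preadditive.comp_sub, Preadditive.comp_sub, hF, hF', reassoc_of% ha', reassoc_of% h,
      Preadditive.sub_comp, sub_self]
  obtain ⟨s, hs⟩ := exists_cosyz_desc _ hd
  refine ⟨injHull Y, s, cosyzProj Y,
    (IsQFRing.projective_iff_injective _).2 inferInstance, ?_⟩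
  rw [← cancel_epi (cosyzProj X)]
  rw [reassoc_of% hs, Preadditive.comp_sub, hg, hg']
  simp [injEmb_cosyzProj]

variable (S)

/-- The translation functor `T` of `StMod(S)`, on objects the cokernel of `X ⟶ I(X)`. -/
noncomputable abbrev stShift : StMod S ⥤ StMod S :=
  CategoryTheory.Quotient.lift (stableRel S)
    { obj := fun X => (toStMod S).obj (cosyz X)
      map := fun f => (toStMod S).map (cosyzMap f)
      map_id := fun X => by
        rw [← (toStMod S).map_id]
        exact CategoryTheory.Quotient.sound _ (cosyz_map_unique
          (stableRel_congruence S |>.equivalence.refl (𝟙 X))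
          (injEmb_injHullMap _) (cosyzProj_cosyzMap _) (F' := 𝟙 _) (by simp) (by simp))
      map_comp := fun {X Y Z} f g => by
        rw [← (toStMod S).map_comp]
        refine CategoryTheory.Quotient.sound _ (cosyz_map_unique
          (stableRel_congruence S |>.equivalence.refl (f ≫ g))
          (injEmb_injHullMap _) (cosyzProj_cosyzMap _) (F' := injHullMap f ≫ injHullMap g) ?_ ?_)
        · rw [reassoc_of% injEmb_injHullMap f, injEmb_injHullMap g, Category.assoc]
        · rw [reassoc_of% cosyzProj_cosyzMap f, cosyzProj_cosyzMap g, Category.assoc] }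
    (fun _ _ _ _ h => CategoryTheory.Quotient.sound _ (cosyz_map_unique h
      (injEmb_injHullMap _) (cosyzProj_cosyzMap _) (injEmb_injHullMap _) (cosyzProj_cosyzMap _)))

/-- The translation functor `T` of `Stmod(S)`. -/
noncomputable abbrev fgShift : FGStMod S ⥤ FGStMod S :=
  (stIsFG S).lift ((stIsFG S).ι ⋙ stShift S) (fun X => cosyz_finite X.obj.as X.property)

/-- The translation `TX` of a finitely generated module, as a finitely generated module. -/
noncomputable abbrev fgCosyz (X : FGModuleCat.{u} S) : FGModuleCat.{u} S :=
  ⟨cosyz X.obj, cosyz_finite X.obj X.property⟩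

variable {S}

/-- The triangles of `Stmod(S)`: the sextuples `U ⟶ V ⟶ W ⟶ TU` that are isomorphic to a
standard one. The standard triangle of a homomorphism `f : X ⟶ Y` in `mod(S)` is
`X ⟶ Y ⟶ C ⟶ TX`, where `C` is the pushout of `X ⟶ I(X)` along `f` and where `C ⟶ TX` is zero on
`Y` and is the projection on `I(X)`. -/
def IsStableTriangle {U V W : FGStMod S} (p : U ⟶ V) (q : V ⟶ W) (r : W ⟶ (fgShift S).obj U) :
    Prop :=
  ∃ (X Y C : FGModuleCat.{u} S) (f : X ⟶ Y) (j : Y ⟶ C) (k : injHull X.obj ⟶ C.obj)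
    (d : C ⟶ fgCosyz S X)
    (a : U ≅ (toFGStMod S).obj X) (b : V ≅ (toFGStMod S).obj Y) (c : W ≅ (toFGStMod S).obj C),
    IsPushout f.hom (injEmb X.obj) j.hom k ∧
    j.hom ≫ d.hom = 0 ∧ k ≫ d.hom = cosyzProj X.obj ∧
    p ≫ b.hom = a.hom ≫ (toFGStMod S).map f ∧
    q ≫ c.hom = b.hom ≫ (toFGStMod S).map j ∧
    r ≫ (fgShift S).map a.hom = c.hom ≫ (toFGStMod S).map d

end Shift

section GrothendieckGroup

variable (S : Type u) [Ring S]

/-- The isomorphism class of an object of `Stmod(S)`. -/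
def stIsoClass {S : Type u} [Ring S] (U : FGStMod S) : _root_.Quotient (isIsomorphicSetoid (FGStMod S)) :=
  _root_.Quotient.mk _ U

variable [IsQFRing S]

/-- The subgroup generated by `[V] - ([U] + [W])` for all triangles `U ⟶ V ⟶ W ⟶ TU`. -/
def triangleRelations :
    AddSubgroup (FreeAbelianGroup (_root_.Quotient (isIsomorphicSetoid (FGStMod S)))) :=
  AddSubgroup.closure
    { x | ∃ (U V W : FGStMod S) (p : U ⟶ V) (q : V ⟶ W) (r : W ⟶ (fgShift S).obj U),
      IsStableTriangle p q r ∧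
      x = FreeAbelianGroup.of (stIsoClass V) -
        (FreeAbelianGroup.of (stIsoClass U) + FreeAbelianGroup.of (stIsoClass W)) }

/-- The Grothendieck group `G̲₀(S) = K₀(Stmod(S))`: the free abelian group on the isomorphism
classes of objects of `Stmod(S)` modulo the relations `[V] = [U] + [W]` given by triangles. -/
abbrev StableG0 := FreeAbelianGroup (_root_.Quotient (isIsomorphicSetoid (FGStMod S))) ⧸
  triangleRelations S

variable {S}

/-- The class in `G̲₀(S)` of an object of `Stmod(S)`. -/
def stableClass (U : FGStMod S) : StableG0 S :=
  QuotientAddGroup.mk (FreeAbelianGroup.of (stIsoClass U))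

end GrothendieckGroup

/-- A module is stably finitely generated if it is isomorphic in `StMod(S)` to a finitely
generated module. -/
def IsStablyFG {S : Type u} [Ring S] (M : ModuleCat.{u} S) : Prop :=
  ∃ M' : FGModuleCat.{u} S, Nonempty ((toStMod S).obj M ≅ (toStMod S).obj M'.obj)

/-- `θ(M) = [M']` for a finitely generated module `M'` that is stably isomorphic to `M`. -/
noncomputable def stableTheta {S : Type u} [Ring S] [IsQFRing S] (M : ModuleCat.{u} S)
    (hM : IsStablyFG M) : StableG0 S :=
  stableClass ((toFGStMod S).obj hM.choose)

/-- `θ(M)` does not depend on the choice of `M'`. -/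
theorem stableTheta_eq {S : Type u} [Ring S] [IsQFRing S] (M : ModuleCat.{u} S)
    (hM : IsStablyFG M) (M' : FGModuleCat.{u} S)
    (e : (toStMod S).obj M ≅ (toStMod S).obj M'.obj) :
    stableTheta M hM = stableClass ((toFGStMod S).obj M') := by
  have h : (toFGStMod S).obj hM.choose ≅ (toFGStMod S).obj M' :=
    ObjectProperty.isoMk _ (hM.choose_spec.some.symm ≪≫ e)
  have : stIsoClass ((toFGStMod S).obj hM.choose) = stIsoClass ((toFGStMod S).obj M') :=
    _root_.Quotient.sound ⟨h⟩
  rw [stableTheta, stableClass, stableClass, this]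

/-! ### Additive structure of the stable category and Schanuel's lemma -/

section Stable

variable {S : Type u} [Ring S]

/-! Up to stable isomorphism, every short exact sequence is determined by its first homomorphism
(`nonempty_stIso_X₃`). If `U` and `V` are stably isomorphic to finitely generated `X` and `Y`,
represent the stable map by `f : X ⟶ Y` and let `C` be its pushout along `X ⟶ I(X)`. The sequence `0
→ X → Y ⊕ I(X) → C → 0` is exact and its middle term is stably `Y`, so `W` is stably `C`, which is
finitely generated. The standard triangle of `f` gives the relation in the Grothendieck group
(`exists_triangle`).

The other two cases reduce to this one by rotating to `0 → K → U ⊕ P → V → 0`, with `P` projective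
and `K` the kernel of a surjection `P → W` (`exists_rotation`). If `W` is stably finitely generated,
so is `K`: by Schanuel's lemma it is stably the kernel of a finite free cover, and a QF-ring is left
Noetherian. -/

theorem stableRel_add {M N : ModuleCat.{u} S} (f₁ f₂ g₁ g₂ : M ⟶ N)
    (hf : stableRel S f₁ f₂) (hg : stableRel S g₁ g₂) : stableRel S (f₁ + g₁) (f₂ + g₂) := by
  obtain ⟨P, a, b, hP, e⟩ := hf
  obtain ⟨Q, c, d, hQ, e'⟩ := hg
  refine ⟨ModuleCat.of S (P × Q), ModuleCat.ofHom (a.hom.prod c.hom),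
    ModuleCat.ofHom (b.hom.coprod d.hom), inferInstance, ?_⟩
  have : f₁ + g₁ - (f₂ + g₂) = a ≫ b + c ≫ d := by rw [e, e']; abel
  rw [this]
  ext x
  simp

/-- The additive structure on the homomorphisms of `StMod(S)`. -/
instance stMod_preadditive : Preadditive (StMod S) :=
  CategoryTheory.Quotient.preadditive (stableRel S) fun _ _ => stableRel_add

instance toStMod_additive : (toStMod S).Additive :=
  CategoryTheory.Quotient.functor_additive (stableRel S) fun _ _ => stableRel_add

theorem toStMod_map_eq_iff {M N : ModuleCat.{u} S} (f g : M ⟶ N) :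
    (toStMod S).map f = (toStMod S).map g ↔ FactorsThroughProjective (f - g) :=
  CategoryTheory.Quotient.functor_map_eq_iff (stableRel S) f g

theorem toStMod_map_eq_zero_iff {M N : ModuleCat.{u} S} (f : M ⟶ N) :
    (toStMod S).map f = 0 ↔ FactorsThroughProjective f := by
  rw [← (toStMod S).map_zero, toStMod_map_eq_iff, sub_zero]

theorem toStMod_map_comp_eq_zero {M P N : ModuleCat.{u} S} (hP : Module.Projective S P)
    (f : M ⟶ P) (g : P ⟶ N) : (toStMod S).map (f ≫ g) = 0 :=
  (toStMod_map_eq_zero_iff _).2 ⟨P, f, g, hP, rfl⟩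

/-- A projective direct summand does not change the stable isomorphism class. -/
def stIsoOfProjectiveSummand {M U P : ModuleCat.{u} S} (hP : Module.Projective S P)
    (fst : M ⟶ U) (inl : U ⟶ M) (snd : M ⟶ P) (inr : P ⟶ M)
    (h : inl ≫ fst = 𝟙 U) (total : fst ≫ inl + snd ≫ inr = 𝟙 M) :
    (toStMod S).obj M ≅ (toStMod S).obj U where
  hom := (toStMod S).map fst
  inv := (toStMod S).map inl
  hom_inv_id := by
    rw [← (toStMod S).map_id, ← total, (toStMod S).map_add, toStMod_map_comp_eq_zero hP,
      add_zero, (toStMod S).map_comp]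
  inv_hom_id := by rw [← (toStMod S).map_comp, h, (toStMod S).map_id]

theorem exists_projective_lift {P M N : ModuleCat.{u} S} (hP : Module.Projective S P)
    (g : M ⟶ N) [Epi g] (f : P ⟶ N) : ∃ h : P ⟶ M, h ≫ g = f := by
  obtain ⟨h, hh⟩ := Module.projective_lifting_property g.hom f.hom
    ((ModuleCat.epi_iff_surjective _).1 inferInstance)
  exact ⟨ModuleCat.ofHom h, by ext x; exact LinearMap.congr_fun hh x⟩

theorem IsStablyFG.of_stIso {M N : ModuleCat.{u} S} (h : IsStablyFG M)
    (e : (toStMod S).obj N ≅ (toStMod S).obj M) : IsStablyFG N :=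
  let ⟨M', ⟨e'⟩⟩ := h
  ⟨M', ⟨e ≪≫ e'⟩⟩

/-- For short exact sequences with projective middle terms, the stable class of the homomorphism
on kernels is determined by that on cokernels. -/
theorem toStMod_map_τ₁_eq_zero {E E' : ShortComplex (ModuleCat.{u} S)} (hE' : E'.ShortExact)
    (hP : Module.Projective S E.X₂) (φ : E ⟶ E')
    (h : (toStMod S).map φ.τ₃ = 0) : (toStMod S).map φ.τ₁ = 0 := by
  obtain ⟨Q, a, b, hQ, e⟩ := (toStMod_map_eq_zero_iff _).1 h
  have := hE'.mono_f
  have := hE'.epi_g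
  obtain ⟨b', hb'⟩ := exists_projective_lift hQ E'.g b
  -- The correction makes `φ.τ₂` land in the kernel of `E'.g` and vanishes on `E.X₁`; hence `φ.τ₁`
  -- factors through the projective `E.X₂`.
  have hz : (φ.τ₂ - E.g ≫ a ≫ b') ≫ E'.g = 0 := by
    rw [Preadditive.sub_comp, φ.comm₂₃, Category.assoc, Category.assoc, hb', e, sub_self]
  have hs := hE'.exact.lift_f _ hz
  set s := hE'.exact.lift _ hz
  have : φ.τ₁ = E.f ≫ s := by
    rw [← cancel_mono E'.f, Category.assoc, hs, Preadditive.comp_sub, φ.comm₁₂]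
    simp
  rw [this]
  exact toStMod_map_comp_eq_zero hP _ _

theorem exists_map_of_projective {E E' : ShortComplex (ModuleCat.{u} S)} (hE' : E'.ShortExact)
    (hP : Module.Projective S E.X₂) (c : E.X₃ ⟶ E'.X₃) : ∃ φ : E ⟶ E', φ.τ₃ = c := by
  have := hE'.mono_f
  have := hE'.epi_g
  obtain ⟨b, hb⟩ := exists_projective_lift hP E'.g (E.g ≫ c)
  have hz : (E.f ≫ b) ≫ E'.g = 0 := by simp [hb]
  exact ⟨⟨hE'.exact.lift _ hz, b, c, hE'.exact.lift_f _ hz, hb⟩, rfl⟩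

/-- Schanuel's lemma in `StMod(S)`: kernels of surjections from projective modules onto stably isomorphic modules are
stably isomorphic. -/
theorem nonempty_stIso_X₁ {E E' : ShortComplex (ModuleCat.{u} S)} (hE : E.ShortExact)
    (hE' : E'.ShortExact) (hP : Module.Projective S E.X₂) (hP' : Module.Projective S E'.X₂)
    (e : (toStMod S).obj E.X₃ ≅ (toStMod S).obj E'.X₃) :
    Nonempty ((toStMod S).obj E.X₁ ≅ (toStMod S).obj E'.X₁) := by
  obtain ⟨c, hc⟩ := (toStMod S).map_surjective e.hom
  obtain ⟨c', hc'⟩ := (toStMod S).map_surjective e.inv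
  obtain ⟨φ, rfl⟩ := exists_map_of_projective hE' hP c
  obtain ⟨ψ, rfl⟩ := exists_map_of_projective hE hP' c'
  refine ⟨⟨(toStMod S).map φ.τ₁, (toStMod S).map ψ.τ₁, ?_, ?_⟩⟩
  · have := toStMod_map_τ₁_eq_zero hE hP (φ ≫ ψ - 𝟙 E) (by simp [hc, hc'])
    simpa [sub_eq_zero] using this
  · have := toStMod_map_τ₁_eq_zero hE' hP' (ψ ≫ φ - 𝟙 E') (by simp [hc, hc'])
    simpa [sub_eq_zero] using this

end Stable

/-! ### Stable isomorphisms between short exact sequences over a QF-ring -/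

section QF

variable {S : Type u} [Ring S] [IsQFRing S]

theorem injHull_projective (X : ModuleCat.{u} S) : Module.Projective S (injHull X) :=
  (IsQFRing.projective_iff_injective _).2 inferInstance

/-- A stably commuting square of short exact sequences can be made to commute. -/
theorem exists_map_of_stable_comm {E E' : ShortComplex (ModuleCat.{u} S)} (hE : E.ShortExact)
    (a : E.X₁ ⟶ E'.X₁) (b : E.X₂ ⟶ E'.X₂)
    (h : (toStMod S).map (E.f ≫ b) = (toStMod S).map (a ≫ E'.f)) :
    ∃ φ : E ⟶ E', φ.τ₁ = a ∧ (toStMod S).map φ.τ₂ = (toStMod S).map b := by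
  obtain ⟨Q, s, t, hQ, e⟩ := (toStMod_map_eq_iff _ _).1 h
  have := hE.mono_f
  have := hE.epi_g
  -- The projective `Q` is also injective, so the error term extends to `E.X₂`; subtracting it from
  -- `b` changes nothing stably and makes the square commute.
  obtain ⟨s', hs'⟩ := exists_injective_extension E.f s
    ((IsQFRing.projective_iff_injective Q).1 hQ)
  have hb : E.f ≫ (b - s' ≫ t) = a ≫ E'.f := by
    rw [Preadditive.comp_sub, reassoc_of% hs', e, sub_sub_cancel]
  have hz : E.f ≫ (b - s' ≫ t) ≫ E'.g = 0 := by rw [reassoc_of% hb, E'.zero, comp_zero]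
  refine ⟨⟨a, b - s' ≫ t, hE.exact.desc _ hz, hb.symm, (hE.exact.g_desc _ hz).symm⟩, rfl, ?_⟩
  rw [(toStMod S).map_sub, toStMod_map_comp_eq_zero hQ, sub_zero]

/-- An endomorphism of a short exact sequence that stably vanishes on the first two terms has
stably square zero on the third. -/
theorem toStMod_map_τ₃_comp_self {E : ShortComplex (ModuleCat.{u} S)} (hE : E.ShortExact)
    (φ : E ⟶ E) (h₁ : (toStMod S).map φ.τ₁ = 0) (h₂ : (toStMod S).map φ.τ₂ = 0) :
    (toStMod S).map φ.τ₃ ≫ (toStMod S).map φ.τ₃ = 0 := by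
  obtain ⟨Q, s, t, hQ, e⟩ := (toStMod_map_eq_zero_iff _).1 h₁
  have := hE.mono_f
  have := hE.epi_g
  obtain ⟨s', hs'⟩ := exists_injective_extension E.f s
    ((IsQFRing.projective_iff_injective Q).1 hQ)
  have hz : E.f ≫ (φ.τ₂ - s' ≫ t ≫ E.f) = 0 := by
    rw [Preadditive.comp_sub, reassoc_of% hs', reassoc_of% e, φ.comm₁₂, sub_self]
  have hr := hE.exact.g_desc _ hz
  set r := hE.exact.desc _ hz
  -- With `φ.τ₃` equal to `r` followed by `E.g`, its square contains `E.g ≫ r`, which is stably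
  -- `φ.τ₂`, hence zero.
  have hc : φ.τ₃ = r ≫ E.g := by
    rw [← cancel_epi E.g, reassoc_of% hr, ← φ.comm₂₃, Preadditive.sub_comp]
    simp
  have h0 : (toStMod S).map (E.g ≫ r) = 0 := by
    rw [hr, (toStMod S).map_sub, h₂, toStMod_map_comp_eq_zero hQ, sub_zero]
  rw [← (toStMod S).map_comp, hc, Category.assoc, ← Category.assoc E.g, (toStMod S).map_comp,
    (toStMod S).map_comp, h0, zero_comp, comp_zero]

/-- The difference of `φ.τ₃` and the identity stably squares to zero, so `φ.τ₃` has the stable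
inverse `2 - φ.τ₃`. -/
theorem isIso_toStMod_map_τ₃_of_endo {E : ShortComplex (ModuleCat.{u} S)} (hE : E.ShortExact)
    (φ : E ⟶ E) (h₁ : (toStMod S).map φ.τ₁ = 𝟙 _) (h₂ : (toStMod S).map φ.τ₂ = 𝟙 _) :
    IsIso ((toStMod S).map φ.τ₃) := by
  have h := toStMod_map_τ₃_comp_self hE (φ - 𝟙 E) (by simp [h₁]) (by simp [h₂])
  have e : (toStMod S).map (φ - 𝟙 E).τ₃ = (toStMod S).map φ.τ₃ - 𝟙 _ := by simp
  rw [e] at h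
  simp only [Preadditive.sub_comp, Preadditive.comp_sub, Category.id_comp, Category.comp_id] at h
  refine ⟨𝟙 _ + 𝟙 _ - (toStMod S).map φ.τ₃, ?_, ?_⟩
  all_goals
    simp only [Preadditive.sub_comp, Preadditive.comp_sub, Preadditive.add_comp,
      Preadditive.comp_add, Category.id_comp, Category.comp_id]
    rw [← sub_eq_zero, ← neg_eq_zero, ← h]
    abel

/-- A morphism of short exact sequences that is a stable isomorphism on the first two terms is
one on the third. -/
theorem isIso_toStMod_map_τ₃ {E E' : ShortComplex (ModuleCat.{u} S)} (hE : E.ShortExact)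
    (hE' : E'.ShortExact) (φ : E ⟶ E') [IsIso ((toStMod S).map φ.τ₁)]
    [IsIso ((toStMod S).map φ.τ₂)] : IsIso ((toStMod S).map φ.τ₃) := by
  obtain ⟨a, ha⟩ := (toStMod S).map_surjective (inv ((toStMod S).map φ.τ₁))
  obtain ⟨b, hb⟩ := (toStMod S).map_surjective (inv ((toStMod S).map φ.τ₂))
  -- `ψ` lifts the stable inverses on the first two terms. It need not invert `φ.τ₃`, but both
  -- composites are stable isomorphisms on the third terms.
  obtain ⟨ψ, rfl, hψ⟩ := exists_map_of_stable_comm (E' := E) hE' a b (by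
    rw [(toStMod S).map_comp, (toStMod S).map_comp, ha, hb, IsIso.comp_inv_eq, Category.assoc,
      IsIso.eq_inv_comp, ← (toStMod S).map_comp, ← (toStMod S).map_comp, φ.comm₁₂])
  have h := isIso_toStMod_map_τ₃_of_endo hE (φ ≫ ψ) (by simp [ha]) (by simp [hψ, hb])
  have h' := isIso_toStMod_map_τ₃_of_endo hE' (ψ ≫ φ) (by simp [ha]) (by simp [hψ, hb])
  rw [ShortComplex.comp_τ₃, (toStMod S).map_comp] at h h'
  have : IsSplitMono ((toStMod S).map φ.τ₃) :=
    ⟨⟨⟨(toStMod S).map ψ.τ₃ ≫ inv ((toStMod S).map φ.τ₃ ≫ (toStMod S).map ψ.τ₃), by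
      rw [← Category.assoc, IsIso.hom_inv_id]⟩⟩⟩
  have : Epi ((toStMod S).map φ.τ₃) :=
    epi_of_epi ((toStMod S).map ψ.τ₃) _
  exact isIso_of_epi_of_isSplitMono _

/-- A stable isomorphism between the first homomorphisms of two short exact sequences extends to
a stable isomorphism of the third terms. -/
theorem nonempty_stIso_X₃ {E E' : ShortComplex (ModuleCat.{u} S)} (hE : E.ShortExact)
    (hE' : E'.ShortExact) (e₁ : (toStMod S).obj E.X₁ ≅ (toStMod S).obj E'.X₁)
    (e₂ : (toStMod S).obj E.X₂ ≅ (toStMod S).obj E'.X₂)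
    (h : (toStMod S).map E.f ≫ e₂.hom = e₁.hom ≫ (toStMod S).map E'.f) :
    Nonempty ((toStMod S).obj E.X₃ ≅ (toStMod S).obj E'.X₃) := by
  obtain ⟨a, ha⟩ := (toStMod S).map_surjective e₁.hom
  obtain ⟨b, hb⟩ := (toStMod S).map_surjective e₂.hom
  obtain ⟨φ, rfl, hφ⟩ := exists_map_of_stable_comm hE a b (by
    rw [(toStMod S).map_comp, (toStMod S).map_comp, ha, hb, h])
  have : IsIso ((toStMod S).map φ.τ₁) := by rw [ha]; infer_instance
  have : IsIso ((toStMod S).map φ.τ₂) := by rw [hφ, hb]; infer_instance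
  have := isIso_toStMod_map_τ₃ hE hE' φ
  exact ⟨asIso ((toStMod S).map φ.τ₃)⟩

/-! ### The Noetherian property -/

variable (S) in
/-- A QF-ring is left Noetherian, since direct sums of injective modules are injective. -/
theorem IsQFRing.isNoetherianRing : IsNoetherianRing S := by
  refine monotone_stabilizes_iff_noetherian.1 fun I => ?_
  let E : ℕ → Type u := fun k => injHull (ModuleCat.of S (S ⧸ I k))
  let ι : ∀ k, (S ⧸ I k) →ₗ[S] E k := fun k => (injEmb (ModuleCat.of S (S ⧸ I k))).hom
  have hι : ∀ k, Function.Injective (ι k) := fun k =>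
    (ModuleCat.mono_iff_injective _).1 inferInstance
  have hE : ∀ k, Module.Projective S (E k) := fun k => injHull_projective _
  have hD : Module.Injective S (Π₀ k, E k) :=
    (IsQFRing.projective_iff_injective _).1 inferInstance
  -- Bass's argument: an element of the union of the chain lies in `I k` for all large `k`, so `g`
  -- maps the union into the direct sum, which is injective.
  let g : S →ₗ[S] ∀ k, E k := LinearMap.pi fun k => ι k ∘ₗ (I k).mkQ
  let c : (Π₀ k, E k) →ₗ[S] ∀ k, E k := DFinsupp.coeFnLinearMap S
  have hc : Function.Injective c := DFunLike.coe_injective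
  have hg0 : ∀ x k, g x k = 0 ↔ x ∈ I k := fun x k => by
    change ι k ((I k).mkQ x) = 0 ↔ _
    rw [map_eq_zero_iff _ (hι k)]
    simp
  have hg : ∀ x : ↥(⨆ k, I k), g x ∈ LinearMap.range c := by
    rintro ⟨x, hx⟩
    obtain ⟨k, hk⟩ := (Submodule.mem_iSup_of_directed _ I.monotone.directed_le).1 hx
    classical
    refine ⟨DFinsupp.mk (Finset.range k) fun n => g x n, funext fun n => ?_⟩
    change (DFinsupp.mk (Finset.range k) fun n => g x n) n = g x n
    rw [DFinsupp.mk_apply]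
    split_ifs with hn
    · rfl
    · exact ((hg0 x n).2 (I.monotone (by simpa using hn) hk)).symm
  let f : ↥(⨆ k, I k) →ₗ[S] (Π₀ k, E k) :=
    (LinearEquiv.ofInjective c hc).symm.toLinearMap ∘ₗ
      (g ∘ₗ (⨆ k, I k).subtype).codRestrict _ hg
  have hf : ∀ x, c (f x) = g x := fun x =>
    congrArg Subtype.val ((LinearEquiv.ofInjective c hc).apply_symm_apply
      ((g ∘ₗ (⨆ k, I k).subtype).codRestrict _ hg x))
  obtain ⟨F, hF⟩ := hD.out (⨆ k, I k).subtype Subtype.val_injective f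
  classical
  -- The extension `F` to `S` is determined by `F 1`, which has finite support; beyond it every
  -- component vanishes on the union.
  obtain ⟨n, hn⟩ := (F 1).support.exists_nat_subset_range
  have hle : ∀ m, n ≤ m → ⨆ k, I k ≤ I m := fun m hm x hx => by
    have h1 : F 1 m = 0 := by
      by_contra h
      have := hn (DFinsupp.mem_support_iff.2 h)
      simp at this
      omega
    rw [← hg0, ← hf ⟨x, hx⟩, ← hF]
    change F x m = 0
    rw [← mul_one x, ← smul_eq_mul, map_smul, DFinsupp.smul_apply, h1, smul_zero]
  exact ⟨n, fun m hm => le_antisymm (I.monotone hm) ((le_iSup I m).trans (hle n le_rfl))⟩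

/-! ### Two out of three and the triangle relation -/

/-- The kernel of a surjection from a projective module onto a stably finitely generated module
is stably finitely generated. -/
theorem IsStablyFG.X₁_of_projective {E : ShortComplex (ModuleCat.{u} S)} (hE : E.ShortExact)
    (hP : Module.Projective S E.X₂) (h : IsStablyFG E.X₃) : IsStablyFG E.X₁ := by
  obtain ⟨W, ⟨e⟩⟩ := h
  have hW : Module.Finite S W.obj := W.property
  obtain ⟨n, f, hf⟩ := Module.Finite.exists_fin' S W.obj
  have := IsQFRing.isNoetherianRing S
  obtain ⟨e'⟩ := nonempty_stIso_X₁ hE (LinearMap.shortExact_shortComplexKer hf) hP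
    (inferInstanceAs (Module.Projective S (Fin n → S))) e
  exact ⟨⟨ModuleCat.of S (LinearMap.ker f),
    inferInstanceAs (Module.Finite S (LinearMap.ker f))⟩, ⟨e'⟩⟩

/-- In a short exact sequence whose first two terms are stably isomorphic to finitely generated
modules, the third term is stably isomorphic to the third term of a triangle. -/
theorem exists_triangle {E : ShortComplex (ModuleCat.{u} S)} (hE : E.ShortExact)
    (X Y : FGModuleCat.{u} S) (e₁ : (toStMod S).obj E.X₁ ≅ (toStMod S).obj X.obj)
    (e₂ : (toStMod S).obj E.X₂ ≅ (toStMod S).obj Y.obj) :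
    ∃ C : FGModuleCat.{u} S, Nonempty ((toStMod S).obj E.X₃ ≅ (toStMod S).obj C.obj) ∧
      stableClass ((toFGStMod S).obj Y) =
        stableClass ((toFGStMod S).obj X) + stableClass ((toFGStMod S).obj C) := by
  -- This `f` is `E.f` transported along `e₁` and `e₂`, so that the pushout sequence below has a
  -- first homomorphism stably isomorphic to `E.f`.
  obtain ⟨f, hf⟩ := (toStMod S).map_surjective (e₁.inv ≫ (toStMod S).map E.f ≫ e₂.hom)
  let sq := IsPushout.of_hasPushout f (injEmb X.obj)
  have hsq : sq.shortComplex.ShortExact :=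
    { exact := sq.exact_shortComplex
      mono_f := by
        have : Mono (biprod.lift f (-injEmb X.obj) ≫ biprod.snd) := by
          rw [biprod.lift_snd]
          infer_instance
        exact mono_of_mono (biprod.lift f (-injEmb X.obj)) biprod.snd
      epi_g := sq.epi_shortComplex_g }
  let e₃ : (toStMod S).obj (Y.obj ⊞ injHull X.obj) ≅ (toStMod S).obj Y.obj :=
    stIsoOfProjectiveSummand (injHull_projective X.obj) biprod.fst biprod.inl biprod.snd
      biprod.inr (by simp) (by simp)
  have hfin : Module.Finite S (pushout f (injEmb X.obj) : ModuleCat.{u} S) := by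
    have := injHull_finite X.obj X.property
    have : Module.Finite S Y.obj := Y.property
    have hs : Function.Surjective (biprod.desc (pushout.inl f (injEmb X.obj))
      (pushout.inr f (injEmb X.obj))).hom :=
        (ModuleCat.epi_iff_surjective _).1 sq.epi_shortComplex_g
    have : Module.Finite S (Y.obj ⊞ injHull X.obj : ModuleCat.{u} S) :=
      Module.Finite.equiv (ModuleCat.biprodIsoProd Y.obj (injHull X.obj)).toLinearEquiv.symm
    exact Module.Finite.of_surjective _ hs
  let C : FGModuleCat.{u} S := ⟨pushout f (injEmb X.obj), hfin⟩
  have hcomm : (toStMod S).map E.f ≫ e₂.hom ≫ e₃.inv =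
      e₁.hom ≫ (toStMod S).map (biprod.lift f (-injEmb X.obj)) := by
    rw [← Category.assoc, Iso.comp_inv_eq, Category.assoc]
    change _ = e₁.hom ≫ _ ≫ (toStMod S).map biprod.fst
    rw [← (toStMod S).map_comp, biprod.lift_fst, hf, Iso.hom_inv_id_assoc]
  refine ⟨C, nonempty_stIso_X₃ hE hsq e₁ (e₂ ≪≫ e₃.symm) hcomm, ?_⟩
  let d : pushout f (injEmb X.obj) ⟶ cosyz X.obj :=
    pushout.desc 0 (cosyzProj X.obj) (by rw [comp_zero, injEmb_cosyzProj])
  let f' : X ⟶ Y := ObjectProperty.homMk f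
  let j : Y ⟶ C := ObjectProperty.homMk (pushout.inl f (injEmb X.obj))
  let d' : C ⟶ fgCosyz S X := ObjectProperty.homMk d
  have htri : IsStableTriangle ((toFGStMod S).map f') ((toFGStMod S).map j)
      ((toFGStMod S).map d' : _ ⟶ (fgShift S).obj ((toFGStMod S).obj X)) := by
    refine ⟨X, Y, C, f', j, pushout.inr f (injEmb X.obj), d', Iso.refl _, Iso.refl _, Iso.refl _,
      sq, pushout.inl_desc _ _ _, pushout.inr_desc _ _ _, by simp, by simp, ?_⟩
    rw [Iso.refl_hom, (fgShift S).map_id, Iso.refl_hom, Category.id_comp]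
    exact Category.comp_id _
  refine (QuotientAddGroup.eq.2 ?_).symm
  rw [neg_add_eq_sub]
  exact AddSubgroup.subset_closure ⟨_, _, _, _, _, _, htri, rfl⟩

theorem IsStablyFG.X₃ {E : ShortComplex (ModuleCat.{u} S)} (hE : E.ShortExact)
    (h₁ : IsStablyFG E.X₁) (h₂ : IsStablyFG E.X₂) : IsStablyFG E.X₃ := by
  obtain ⟨X, ⟨e₁⟩⟩ := h₁
  obtain ⟨Y, ⟨e₂⟩⟩ := h₂
  obtain ⟨C, e, -⟩ := exists_triangle hE X Y e₁ e₂
  exact ⟨C, e⟩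

/-- A short exact sequence `0 ⟶ U ⟶ V ⟶ W ⟶ 0` can be rotated to `0 ⟶ K ⟶ M ⟶ V ⟶ 0`, where `K`
is the kernel of a surjection from a projective module onto `W`, and `M` is stably isomorphic to
`U`. -/
theorem exists_rotation {E : ShortComplex (ModuleCat.{u} S)} (hE : E.ShortExact) :
    ∃ (K M : ModuleCat.{u} S) (a : K ⟶ M) (b : M ⟶ E.X₂) (w : a ≫ b = 0),
      (ShortComplex.mk a b w).ShortExact ∧
      (IsStablyFG E.X₃ → IsStablyFG K) ∧
      Nonempty ((toStMod S).obj M ≅ (toStMod S).obj E.X₁) := by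
  let P : Type u := E.X₃ →₀ S
  let q : P →ₗ[S] E.X₃ := Finsupp.linearCombination S id
  have hq : Function.Surjective q := Finsupp.linearCombination_id_surjective S E.X₃
  obtain ⟨s, hs⟩ := Module.projective_lifting_property E.g.hom q hE.moduleCat_surjective_g
  have hs' : ∀ x, E.g (s x) = q x := fun x => LinearMap.congr_fun hs x
  let b : (E.X₁ × P) →ₗ[S] E.X₂ := E.f.hom.coprod s
  have hb' : ∀ x y, b (x, y) = E.f x + s y := fun x y => by simp [b]
  have hfg : ∀ x, E.g (E.f x) = 0 := fun x => ShortComplex.moduleCat_zero_apply E x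
  have hqb : ∀ x y, b (x, y) = 0 → q y = 0 := fun x y h => by
    rw [← hs', ← zero_add (E.g (s y)), ← hfg x, ← map_add, ← hb', h, map_zero, hfg]
  have hex := (ShortComplex.moduleCat_exact_iff E).1 hE.exact
  have hb : Function.Surjective b := fun v => by
    obtain ⟨y, hy⟩ := hq (E.g v)
    obtain ⟨x, hx⟩ := hex (v - s y) (by rw [map_sub, hs', hy, sub_self])
    exact ⟨(x, y), by rw [hb', hx, sub_add_cancel]⟩
  -- The second coordinate identifies the kernel of `b` with that of `q`: if `q y = 0`, then `s y`
  -- comes from a unique element of `E.X₁`.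
  let k : LinearMap.ker b →ₗ[S] P := LinearMap.snd S E.X₁ P ∘ₗ (LinearMap.ker b).subtype
  have hqk : q ∘ₗ k = 0 := LinearMap.ext fun z => hqb z.1.1 z.1.2 z.2
  have hk : Function.Injective k := by
    rintro ⟨⟨x, y⟩, hxy⟩ ⟨⟨x', y'⟩, hxy'⟩ (rfl : y = y')
    rw [LinearMap.mem_ker, hb'] at hxy hxy'
    have hx : E.f x = E.f x' := add_right_cancel (hxy.trans hxy'.symm)
    obtain rfl := hE.moduleCat_injective_f hx
    rfl
  have hkq : Function.Exact k q := fun y => by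
    refine ⟨fun hy => ?_, ?_⟩
    · obtain ⟨x, hx⟩ := hex (s y) (by rw [hs']; exact hy)
      exact ⟨⟨(-x, y), by rw [LinearMap.mem_ker, hb', map_neg, hx, neg_add_cancel]⟩, rfl⟩
    · rintro ⟨z, rfl⟩
      exact LinearMap.congr_fun hqk z
  have hK : (ShortComplex.mk (X₁ := ModuleCat.of S (LinearMap.ker b)) (ModuleCat.ofHom k)
      (ModuleCat.ofHom q) (by rw [← ModuleCat.ofHom_comp, hqk]; rfl)).ShortExact :=
    ModuleCat.shortComplex_shortExact _ hkq hk hq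
  refine ⟨ModuleCat.of S (LinearMap.ker b), ModuleCat.of S (E.X₁ × P),
    ModuleCat.ofHom (LinearMap.ker b).subtype, ModuleCat.ofHom b, _,
    LinearMap.shortExact_shortComplexKer hb,
    fun h => IsStablyFG.X₁_of_projective hK (inferInstanceAs (Module.Projective S P)) h,
    ⟨stIsoOfProjectiveSummand (P := ModuleCat.of S P) (inferInstanceAs (Module.Projective S P))
      (ModuleCat.ofHom (LinearMap.fst S E.X₁ P)) (ModuleCat.ofHom (LinearMap.inl S E.X₁ P))
      (ModuleCat.ofHom (LinearMap.snd S E.X₁ P)) (ModuleCat.ofHom (LinearMap.inr S E.X₁ P))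
      ?_ ?_⟩⟩
  · ext x; rfl
  · ext x <;> simp

/-- After rotation `E.X₂` is the third term, and the first two are stably finitely generated. -/
theorem IsStablyFG.X₂ {E : ShortComplex (ModuleCat.{u} S)} (hE : E.ShortExact)
    (h₁ : IsStablyFG E.X₁) (h₃ : IsStablyFG E.X₃) : IsStablyFG E.X₂ := by
  obtain ⟨K, M, a, b, w, h, hK, ⟨e⟩⟩ := exists_rotation hE
  exact IsStablyFG.X₃ h (hK h₃) (h₁.of_stIso e)

/-- After rotation `E.X₁` is stably the middle term, which the previous case covers. -/
theorem IsStablyFG.X₁ {E : ShortComplex (ModuleCat.{u} S)} (hE : E.ShortExact)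
    (h₂ : IsStablyFG E.X₂) (h₃ : IsStablyFG E.X₃) : IsStablyFG E.X₁ := by
  obtain ⟨K, M, a, b, w, h, hK, ⟨e⟩⟩ := exists_rotation hE
  exact (IsStablyFG.X₂ h (hK h₃) h₂).of_stIso e.symm

end QF

theorem lemma2p2 {S : Type u} [Ring S] [IsQFRing S] {U V W : ModuleCat.{u} S}
    (i : U ⟶ V) (p : V ⟶ W) (hi : Function.Injective i) (hip : Function.Exact i p)
    (hp : Function.Surjective p) :
    (IsStablyFG U → IsStablyFG V → IsStablyFG W) ∧
    (IsStablyFG U → IsStablyFG W → IsStablyFG V) ∧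
    (IsStablyFG V → IsStablyFG W → IsStablyFG U) ∧
    ∀ (hU : IsStablyFG U) (hV : IsStablyFG V) (hW : IsStablyFG W),
      stableTheta V hV = stableTheta U hU + stableTheta W hW := by
  have hE : (ShortComplex.mk i p (by ext x; exact hip.apply_apply_eq_zero x)).ShortExact :=
    ModuleCat.shortComplex_shortExact _ hip hi hp
  refine ⟨fun hU hV => IsStablyFG.X₃ hE hU hV, fun hU hW => IsStablyFG.X₂ hE hU hW,
    fun hV hW => IsStablyFG.X₁ hE hV hW, fun hU hV hW => ?_⟩
  obtain ⟨U', ⟨e₁⟩⟩ := id hU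
  obtain ⟨V', ⟨e₂⟩⟩ := id hV
  -- Since `θ(W)` is independent of the representative, it may be computed with the third term of
  -- the triangle.
  obtain ⟨W', ⟨e₃⟩, h⟩ := exists_triangle hE U' V' e₁ e₂
  rw [stableTheta_eq U hU U' e₁, stableTheta_eq V hV V' e₂, stableTheta_eq W hW W' e₃, h]
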